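/- Let $n\ge 3$, let $\mathfrak m$ be the space of real skew-symmetric $n\times n$ matrices that vanish outside the first row and the first column, let $\mathfrak k$ be the space of real skew-symmetric $n\times n$ matrices whose first row and first column vanish, and regard $SO(n-1)$ as the subgroup of block matrices $\mathrm{diag}(1,R)$ of $SO(n)$. Consider the control system on $SO(n)$ $$\dot\Theta=\Big[\Omega_d+\sum_{i=1}^m v_i\,\Omega_i\Big]\Theta,\qquad \Theta(0)=I,$$ where $\Omega_d\in\mathfrak m$ is such that $t\mapsto\exp(t\Omega_d)$ has (minimal) period $2\pi$, $\Omega_1,\dots,\Omega_m\in\mathfrak k$, and the control $v=(v_1,\dots,v_m):[0,\infty)\to\mathbb R^m$ is an arbitrary locally bounded measurable function. Suppose that the closed subgroup $K$ of $SO(n)$ generated by $\exp\{\Omega_1,\dots,\Omega_m\}_{LA}$ is $SO(n-1)$, where $\{\Omega_1,\dots,\Omega_m\}_{LA}$ is the Lie algebra generated by the $\Omega_i$. For $T\ge 0$ let $\mathbf R(I,T)\subseteq SO(n)$ be the set of all points $\Theta(t)$ with $0\le t\le T$, where $\Theta$ is the solution for some such control, and let $$t^*(\Theta_F)=\inf\{T\ge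 0 : \Theta_F\in\overline{\mathbf R(I,T)}\}.$$ Then for every $\Theta_F\in SO(n)$ there is a unique $\beta\in[0,\pi]$ such that $\Theta_F=\Theta_1\exp(\beta\,\Omega_d)\,\Theta_2$ for some $\Theta_1,\Theta_2\in K$. The set of times $T$ in the infimum is non-empty, and for this $\beta$ the infimizing time is $t^*(\Theta_F)=\beta$. -/

import Mathlib

namespace SOControl

open scoped Matrix

/- The bracket of matrices is the commutator. -/
attribute [local instance] LieRing.ofAssociativeRing

/-- The group `SO(n)` of real orthogonal `n × n` matrices of determinant one. -/
abbrev SO (n : ℕ) : Type := Matrix.specialOrthogonalGroup (Fin n) ℝ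

/-- The space `𝔪` of skew-symmetric matrices that vanish outside the first row and column. -/
def mPart (n : ℕ) [NeZero n] : Set (Matrix (Fin n) (Fin n) ℝ) :=
  {A | Aᵀ = -A ∧ ∀ i j : Fin n, i ≠ 0 → j ≠ 0 → A i j = 0}

/-- The space `𝔨` of skew-symmetric matrices that vanish in the first row and column. -/
def kPart (n : ℕ) [NeZero n] : Set (Matrix (Fin n) (Fin n) ℝ) :=
  {A | Aᵀ = -A ∧ ∀ i : Fin n, A 0 i = 0 ∧ A i 0 = 0}

/-- `SO(n-1)` as a subset of `SO(n)`, embedded as the block matrices `diag(1, R)`: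
the first row and the first column are those of the identity matrix. -/
def subSO (n : ℕ) [NeZero n] : Set (SO n) :=
  {g | ∀ i : Fin n, (g : Matrix (Fin n) (Fin n) ℝ) 0 i = (1 : Matrix (Fin n) (Fin n) ℝ) 0 i ∧
    (g : Matrix (Fin n) (Fin n) ℝ) i 0 = (1 : Matrix (Fin n) (Fin n) ℝ) i 0}

/-- The closed subgroup of `SO(n)` generated by `exp {Ω₁, …, Ω_m}_LA`, where
`{Ω₁, …, Ω_m}_LA` is the real Lie algebra of matrices generated by the `Ω_k`. -/
def controlGroup {n m : ℕ} (Ω : Fin m → Matrix (Fin n) (Fin n) ℝ) : Set (SO n) :=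
  closure (Subgroup.closure
    {g : SO n | ∃ X ∈ LieSubalgebra.lieSpan ℝ (Matrix (Fin n) (Fin n) ℝ) (Set.range Ω),
      (g : Matrix (Fin n) (Fin n) ℝ) = NormedSpace.exp X} : Set (SO n))

/-- The minimal positive period of the one-parameter group `t ↦ exp (t A)` is `T`. -/
def ExpHasPeriod {n : ℕ} (A : Matrix (Fin n) (Fin n) ℝ) (T : ℝ) : Prop :=
  IsLeast {S : ℝ | 0 < S ∧ Function.Periodic (fun t : ℝ => NormedSpace.exp (t • A)) S} T

/-- Admissible controls: measurable and bounded on every compact interval `[0, T]`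
(only the values on `[0, ∞)` matter). -/
def IsControl {m : ℕ} (v : ℝ → Fin m → ℝ) : Prop :=
  Measurable v ∧ ∀ T : ℝ, ∃ C : ℝ, ∀ t ∈ Set.Icc 0 T, ∀ k : Fin m, |v t k| ≤ C

/-- `U` solves `U' = (Ω_d + ∑ v_k Ω_k) U`, `U(0) = I`, on `[0, ∞)` in the sense of Carathéodory,
that is, `U` is continuous and satisfies the integrated equation (written entrywise). -/
def IsTrajectory {n m : ℕ} (Ωd : Matrix (Fin n) (Fin n) ℝ)
    (Ω : Fin m → Matrix (Fin n) (Fin n) ℝ) (v : ℝ → Fin m → ℝ) (U : ℝ → SO n) : Prop :=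
  ContinuousOn U (Set.Ici 0) ∧
    ∀ t : ℝ, 0 ≤ t → ∀ i j : Fin n,
      (U t : Matrix (Fin n) (Fin n) ℝ) i j = (1 : Matrix (Fin n) (Fin n) ℝ) i j +
        ∫ s in (0 : ℝ)..t,
          ((Ωd + ∑ k, v s k • Ω k) * (U s : Matrix (Fin n) (Fin n) ℝ)) i j

/-- The set `R(I, t)` of all points attainable from the identity at time `t`. -/
def reachableAt {n m : ℕ} (Ωd : Matrix (Fin n) (Fin n) ℝ)
    (Ω : Fin m → Matrix (Fin n) (Fin n) ℝ) (t : ℝ) : Set (SO n) :=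
  {g | ∃ (v : ℝ → Fin m → ℝ) (U : ℝ → SO n), IsControl v ∧ IsTrajectory Ωd Ω v U ∧ U t = g}

/-- The set `𝐑(I, T) = ⋃_{0 ≤ t ≤ T} R(I, t)`. -/
def reachableWithin {n m : ℕ} (Ωd : Matrix (Fin n) (Fin n) ℝ)
    (Ω : Fin m → Matrix (Fin n) (Fin n) ℝ) (T : ℝ) : Set (SO n) :=
  ⋃ t ∈ Set.Icc 0 T, reachableAt Ωd Ω t

/-- The times `t ≥ 0` with `g` in the closure of `𝐑(I, t)`. -/
def steeringTimes {n m : ℕ} (Ωd : Matrix (Fin n) (Fin n) ℝ)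
    (Ω : Fin m → Matrix (Fin n) (Fin n) ℝ) (g : SO n) : Set ℝ :=
  {t | 0 ≤ t ∧ g ∈ closure (reachableWithin Ωd Ω t)}

/-- The infimizing time `t*(g)`. -/
noncomputable def infimizingTime {n m : ℕ} (Ωd : Matrix (Fin n) (Fin n) ℝ)
    (Ω : Fin m → Matrix (Fin n) (Fin n) ℝ) (g : SO n) : ℝ :=
  sInf (steeringTimes Ωd Ω g)

/-- `g = Θ₁ exp(β Ω_d) Θ₂` for some `Θ₁, Θ₂ ∈ K`. -/
def HasDecomposition {n : ℕ} (K : Set (SO n)) (Ωd : Matrix (Fin n) (Fin n) ℝ)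
    (g : SO n) (β : ℝ) : Prop :=
  ∃ Θ₁ ∈ K, ∃ Θ₂ ∈ K, (g : Matrix (Fin n) (Fin n) ℝ) =
    (Θ₁ : Matrix (Fin n) (Fin n) ℝ) * NormedSpace.exp (β • Ωd) *
      (Θ₂ : Matrix (Fin n) (Fin n) ℝ)

end SOControl

/-! The entry `g 0 0` is unchanged when `g` is multiplied on either side by `SO(n-1)`, and it equals
`cos β` on `K exp(β Ω_d) K`. Since `cos` is injective on `[0, π]`, this gives uniqueness of `β`;
existence follows from transitivity of `SO(n-1)` on the spheres orthogonal to `e₀`.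

Upper bound: large controls over short times make the drift negligible, so every element of `K` is
approximated in arbitrarily short time (`controlGroup_subset_instantSubgroup`). Only the factor
`exp(β Ω_d)` costs time, namely `β`.

Lower bound: the controls do not enter the derivative of `f = U 0 0`. The period makes the first row
of `Ω_d` a unit vector, so Cauchy–Schwarz gives `f' ≥ -√(1 - f²)`, hence `f(t) ≥ cos t` for `t < π`
(`cos_le_apply_zero_zero`). This closed condition survives taking closures. -/

namespace SOControl

open Filter Topology

/-! ### Exponentials in a Banach algebra. -/

section BanachAlgebra

variable {𝔸 : Type*} [NormedRing 𝔸]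

/-- Telescoping: contractions do not amplify the error of each factor. -/
theorem norm_pow_sub_pow_le {a b : 𝔸} (ha : ‖a‖ ≤ 1) (hb : ‖b‖ ≤ 1) (hone : ‖(1 : 𝔸)‖ ≤ 1)
    (n : ℕ) : ‖a ^ n - b ^ n‖ ≤ n * ‖a - b‖ := by
  have hpow : ∀ k : ℕ, ‖b ^ k‖ ≤ 1 := by
    intro k
    induction k with
    | zero => simpa using hone
    | succ k ih =>
      rw [pow_succ]
      exact (norm_mul_le _ _).trans (mul_le_one₀ ih (norm_nonneg _) hb)
  induction n with
  | zero => simp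
  | succ n ih =>
    have h : a ^ (n + 1) - b ^ (n + 1) = a * (a ^ n - b ^ n) + (a - b) * b ^ n := by
      rw [pow_succ', pow_succ']; noncomm_ring
    rw [h]
    calc ‖a * (a ^ n - b ^ n) + (a - b) * b ^ n‖
        ≤ ‖a * (a ^ n - b ^ n)‖ + ‖(a - b) * b ^ n‖ := norm_add_le _ _
      _ ≤ ‖a‖ * ‖a ^ n - b ^ n‖ + ‖a - b‖ * ‖b ^ n‖ :=
          add_le_add (norm_mul_le _ _) (norm_mul_le _ _)
      _ ≤ 1 * (n * ‖a - b‖) + ‖a - b‖ * 1 := by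
          gcongr
          exact hpow n
      _ = (n + 1 : ℕ) * ‖a - b‖ := by push_cast; ring

variable [NormedAlgebra ℝ 𝔸] [CompleteSpace 𝔸]

/-- Powers of a contractive curve through `1` converge to the exponential of its velocity. -/
theorem tendsto_pow_exp_of_hasDerivAt {F : ℝ → 𝔸} {z : 𝔸} (hone : ‖(1 : 𝔸)‖ ≤ 1)
    (hF : HasDerivAt F z 0) (h0 : F 0 = 1) (hF1 : ∀ t, ‖F t‖ ≤ 1)
    (hz : ∀ t : ℝ, ‖NormedSpace.exp (t • z)‖ ≤ 1) :
    Tendsto (fun k : ℕ => F (1 / ((k : ℝ) + 1)) ^ (k + 1)) atTop (𝓝 (NormedSpace.exp z)) := by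
  have hE : HasDerivAt (fun t : ℝ => NormedSpace.exp (t • z)) z 0 := by
    simpa using hasDerivAt_exp_smul_const (𝕂 := ℝ) z (0 : ℝ)
  have hD : HasDerivAt (F - fun t : ℝ => NormedSpace.exp (t • z)) 0 0 := by
    simpa using hF.sub hE
  have hlim : Tendsto (fun k : ℕ => 1 / ((k : ℝ) + 1)) atTop (𝓝[≠] 0) :=
    tendsto_nhdsWithin_iff.2 ⟨tendsto_one_div_add_atTop_nhds_zero_nat,
      Eventually.of_forall fun k => (Nat.one_div_pos_of_nat (α := ℝ)).ne'⟩
  have hslope := ((hasDerivAt_iff_tendsto_slope_zero.1 hD).comp hlim).norm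
  rw [tendsto_iff_norm_sub_tendsto_zero]
  rw [norm_zero] at hslope
  refine squeeze_zero (fun _ => norm_nonneg _) (fun k => ?_) hslope
  have hexp : NormedSpace.exp z = NormedSpace.exp ((1 / ((k : ℝ) + 1)) • z) ^ (k + 1) := by
    let _ : NormedAlgebra ℚ 𝔸 := NormedAlgebra.restrictScalars ℚ ℝ 𝔸
    rw [← NormedSpace.exp_nsmul, ← Nat.cast_smul_eq_nsmul ℝ, smul_smul]
    push_cast
    rw [mul_one_div_cancel (by positivity), one_smul]
  rw [hexp]
  -- The bound `(k+1)‖F - exp‖` at time `1/(k+1)` is the norm of a difference quotient of a function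
  -- with zero derivative.
  refine (norm_pow_sub_pow_le (hF1 _) (hz _) hone (k + 1)).trans (le_of_eq ?_)
  have hk : ‖(k : ℝ) + 1‖ = k + 1 := Real.norm_of_nonneg (by positivity)
  simp [h0, norm_smul, hk]

/-- The Rodrigues formula. -/
theorem exp_smul_of_pow_three_eq {a : 𝔸} {r : ℝ} (hr : r ≠ 0)
    (ha : a * (a * a) = -(r ^ 2) • a) (t : ℝ) :
    NormedSpace.exp (t • a) =
      1 + (Real.sin (r * t) / r) • a + ((1 - Real.cos (r * t)) / r ^ 2) • (a * a) := by
  -- `G` solves `G' = a G` with `G 0 = 1`, so `exp(-t a) G t` is constant.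
  set G : ℝ → 𝔸 := fun t =>
    1 + (Real.sin (r * t) / r) • a + ((1 - Real.cos (r * t)) / r ^ 2) • (a * a) with hG
  have hG' : ∀ t, HasDerivAt G (a * G t) t := by
    intro t
    have hl : HasDerivAt (fun t : ℝ => r * t) r t := by simpa using (hasDerivAt_id t).const_mul r
    have h1 := ((hl.sin).div_const r).smul_const a
    have h2 := ((hl.cos.const_sub 1).div_const (r ^ 2)).smul_const (a * a)
    have h := (h1.const_add 1).add h2
    convert! h using 1
    · simp only [hG, mul_add, mul_one, mul_smul_comm, ha, smul_smul]
      rw [show -(-Real.sin (r * t) * r) / r ^ 2 = Real.sin (r * t) / r by field_simp,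
        show Real.cos (r * t) * r / r = Real.cos (r * t) by field_simp,
        show (1 - Real.cos (r * t)) / r ^ 2 * -r ^ 2 = Real.cos (r * t) - 1 by
          field_simp; ring]
      module
  have hcomm : ∀ t : ℝ, HasDerivAt (fun t : ℝ => NormedSpace.exp (t • (-a)) * G t) 0 t := by
    intro t
    have h := (hasDerivAt_exp_smul_const (𝕂 := ℝ) (-a) t).mul (hG' t)
    convert! h using 1
    noncomm_ring
  have hconst := is_const_of_deriv_eq_zero (fun t => (hcomm t).differentiableAt)
    (fun t => (hcomm t).deriv) t 0
  have hG0 : G 0 = 1 := by simp [hG]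
  simp only [hG0, zero_smul, NormedSpace.exp_zero, one_mul] at hconst
  have hinv : NormedSpace.exp (t • a) * NormedSpace.exp (t • (-a)) = 1 := by
    let _ : NormedAlgebra ℚ 𝔸 := NormedAlgebra.restrictScalars ℚ ℝ 𝔸
    rw [← NormedSpace.exp_add_of_commute ((Commute.refl a).neg_right.smul_left t |>.smul_right t)]
    simp
  calc NormedSpace.exp (t • a)
      = NormedSpace.exp (t • a) * (NormedSpace.exp (t • (-a)) * G t) := by rw [hconst, mul_one]
    _ = G t := by rw [← mul_assoc, hinv, one_mul]

end BanachAlgebra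

/-! ### Comparison with the cosine. -/

/-- A function starting at `1` whose velocity is at most that of the cosine stays above it. -/
theorem cos_le_of_neg_sqrt_le_deriv {f f' : ℝ → ℝ} {T : ℝ} (hT : T < Real.pi)
    (hf : ContinuousOn f (Set.Icc 0 T))
    (hf' : ∀ t ∈ Set.Ico 0 T, HasDerivWithinAt f (f' t) (Set.Ici t) t)
    (h0 : f 0 = 1) (hbound : ∀ t ∈ Set.Ico 0 T, -√(1 - f t ^ 2) ≤ f' t) (hT0 : 0 ≤ T) :
    Real.cos T ≤ f T := by
  -- The square root is not Lipschitz at the starting value `1`. The perturbed cosine is a strict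
  -- barrier: it starts lower and, at a contact, falls faster by the factor `1 + ε`. The range of
  -- `ε` keeps its argument below `π`.
  have key : ∀ ε ∈ Set.Ioo 0 ((Real.pi - T) / (T + 1)), Real.cos ((1 + ε) * T + ε) ≤ f T := by
    rintro ε ⟨hε, hε'⟩
    rw [lt_div_iff₀ (by linarith)] at hε'
    have hB : ∀ x : ℝ, HasDerivAt (fun t => -Real.cos ((1 + ε) * t + ε))
        ((1 + ε) * Real.sin ((1 + ε) * x + ε)) x := by
      intro x
      have hl : HasDerivAt (fun t : ℝ => (1 + ε) * t + ε) (1 + ε) x := by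
        simpa using ((hasDerivAt_id x).const_mul (1 + ε)).add_const ε
      convert! hl.cos.neg using 1
      ring
    have := image_le_of_deriv_right_lt_deriv_boundary (f := fun t => -f t)
      (f' := fun t => -f' t) hf.neg (fun t ht => (hf' t ht).neg)
      (B := fun t => -Real.cos ((1 + ε) * t + ε)) (by simpa [h0] using Real.cos_le_one ε) hB
      (by
        intro t ht heq
        have hpos : 0 < Real.sin ((1 + ε) * t + ε) := by
          apply Real.sin_pos_of_pos_of_lt_pi
          · have := ht.1
            positivity
          · have : (1 + ε) * t ≤ (1 + ε) * T := by
              have := ht.2.le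
              gcongr
            nlinarith
        have hft : f t = Real.cos ((1 + ε) * t + ε) := neg_injective heq
        have hb := hbound t ht
        rw [hft, ← Real.abs_sin_eq_sqrt_one_sub_cos_sq, abs_of_pos hpos] at hb
        nlinarith)
      (Set.right_mem_Icc.2 hT0)
    simpa using this
  have hlim : Tendsto (fun ε : ℝ => Real.cos ((1 + ε) * T + ε)) (𝓝[>] 0) (𝓝 (Real.cos T)) := by
    have : Continuous fun ε : ℝ => Real.cos ((1 + ε) * T + ε) := by fun_prop
    simpa using (this.tendsto 0).mono_left nhdsWithin_le_nhds
  refine le_of_tendsto hlim ?_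
  have hpos : 0 < (Real.pi - T) / (T + 1) := div_pos (by linarith) (by linarith)
  filter_upwards [Ioo_mem_nhdsGT hpos] with ε hε
  exact key ε hε

end SOControl

/-! ### The group `SO(n)`, reflections and the stabilizer of `e₀`. -/

namespace SOControl

open scoped Matrix
open Matrix

variable {n : ℕ}

theorem mem_SO_iff {A : Matrix (Fin n) (Fin n) ℝ} :
    A ∈ Matrix.specialOrthogonalGroup (Fin n) ℝ ↔ A * Aᵀ = 1 ∧ A.det = 1 := by
  rw [mem_specialOrthogonalGroup_iff, mem_orthogonalGroup_iff]

theorem SO_mul_transpose (g : SO n) : (g : Matrix (Fin n) (Fin n) ℝ) * (g.1)ᵀ = 1 :=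
  (mem_SO_iff.1 g.2).1

theorem SO_transpose_mul (g : SO n) : (g.1)ᵀ * (g : Matrix (Fin n) (Fin n) ℝ) = 1 :=
  mul_eq_one_comm.1 (SO_mul_transpose g)

theorem SO_coe_inv (g : SO n) :
    ((g⁻¹ : SO n) : Matrix (Fin n) (Fin n) ℝ) = (g : Matrix (Fin n) (Fin n) ℝ)ᵀ := rfl

theorem continuous_SO_inv : Continuous fun g : SO n => g⁻¹ :=
  Continuous.subtype_mk (continuous_subtype_val.matrix_transpose) _

open scoped Matrix.Norms.L2Operator in
theorem norm_le_one_of_mem_SO {A : Matrix (Fin n) (Fin n) ℝ}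
    (h : A ∈ Matrix.specialOrthogonalGroup (Fin n) ℝ) : ‖A‖ ≤ 1 := by
  have h1 : A * star A = 1 := by
    rw [star_eq_conjTranspose, conjTranspose_eq_transpose_of_trivial]
    exact (mem_SO_iff.1 h).1
  have h2 := CStarRing.norm_self_mul_star (x := A)
  rw [h1] at h2
  have h3 : ‖(1 : Matrix (Fin n) (Fin n) ℝ)‖ * ‖(1 : Matrix (Fin n) (Fin n) ℝ)‖
      = ‖(1 : Matrix (Fin n) (Fin n) ℝ)‖ := by
    simpa using (CStarRing.norm_star_mul_self (x := (1 : Matrix (Fin n) (Fin n) ℝ))).symm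
  have h4 : ‖(1 : Matrix (Fin n) (Fin n) ℝ)‖ ≤ 1 := by
    by_contra hlt
    nlinarith
  nlinarith [norm_nonneg A]

theorem exp_mem_SO {A : Matrix (Fin n) (Fin n) ℝ} (hA : Aᵀ = -A) :
    NormedSpace.exp A ∈ Matrix.specialOrthogonalGroup (Fin n) ℝ := by
  have horth : ∀ B : Matrix (Fin n) (Fin n) ℝ, Bᵀ = -B →
      NormedSpace.exp B * (NormedSpace.exp B)ᵀ = 1 := by
    intro B hB
    rw [← Matrix.exp_transpose, hB, ← Matrix.exp_add_of_commute _ _ (Commute.refl B).neg_right]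
    simp
  refine mem_SO_iff.2 ⟨horth A hA, ?_⟩
  -- For `E = exp(A/2)`, `det (exp A) = (det E)² = det (E Eᵀ) = 1`, which excludes `-1` without a
  -- connectedness argument.
  have hhalf : ((1 / 2 : ℝ) • A)ᵀ = -((1 / 2 : ℝ) • A) := by
    rw [transpose_smul, hA, smul_neg]
  have h := congrArg det (horth _ hhalf)
  rw [det_mul, det_transpose, det_one, ← det_mul,
    ← Matrix.exp_add_of_commute _ _ (Commute.refl _), ← add_smul] at h
  norm_num at h
  exact h

/-- The exponential of a skew-symmetric matrix as an element of `SO(n)`. -/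
noncomputable def expSO (A : Matrix (Fin n) (Fin n) ℝ) (hA : Aᵀ = -A) : SO n :=
  ⟨NormedSpace.exp A, exp_mem_SO hA⟩

theorem smul_skew {A : Matrix (Fin n) (Fin n) ℝ} (hA : Aᵀ = -A) (t : ℝ) :
    (t • A)ᵀ = -(t • A) := by
  rw [transpose_smul, hA, smul_neg]

/-- The reflection in the hyperplane orthogonal to `a`. -/
noncomputable def householder (a : Fin n → ℝ) : Matrix (Fin n) (Fin n) ℝ :=
  1 + vecMulVec ((-2 / (a ⬝ᵥ a)) • a) a

theorem householder_mulVec (a x : Fin n → ℝ) :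
    householder a *ᵥ x = x - (2 * (a ⬝ᵥ x) / (a ⬝ᵥ a)) • a := by
  rw [householder, add_mulVec, one_mulVec, vecMulVec_mulVec]
  ext i
  simp
  ring

theorem householder_transpose (a : Fin n → ℝ) : (householder a)ᵀ = householder a := by
  rw [householder, transpose_add, transpose_one, transpose_vecMulVec]
  ext i j
  simp [vecMulVec_apply, mul_left_comm]

theorem householder_mul_transpose {a : Fin n → ℝ} (ha : a ⬝ᵥ a ≠ 0) :
    householder a * (householder a)ᵀ = 1 := by
  rw [householder_transpose, householder, mul_add, add_mul, add_mul, vecMulVec_mul_vecMulVec]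
  ext i j
  simp [vecMulVec_apply]
  field_simp
  ring

theorem det_householder {a : Fin n → ℝ} (ha : a ⬝ᵥ a ≠ 0) : (householder a).det = -1 := by
  rw [householder, vecMulVec_eq Unit, det_one_add_replicateCol_mul_replicateRow, dotProduct_smul]
  simp only [smul_eq_mul]
  field_simp
  norm_num

theorem dotProduct_self_pos {a : Fin n → ℝ} (ha : a ≠ 0) : 0 < a ⬝ᵥ a :=
  lt_of_le_of_ne (Finset.sum_nonneg fun i _ => mul_self_nonneg (a i))
    fun h => ha (dotProduct_self_eq_zero.1 h.symm)

variable [NeZero n]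

/-- The transpose is the inverse and also fixes `e₀`, so the column condition yields the row
condition. -/
theorem mem_subSO_of_mulVec {g : SO n}
    (h : (g : Matrix (Fin n) (Fin n) ℝ) *ᵥ Pi.single 0 1 = Pi.single 0 1) : g ∈ subSO n := by
  have h' : (g.1)ᵀ *ᵥ Pi.single 0 1 = Pi.single 0 1 := by
    conv_lhs => rw [← h]
    rw [mulVec_mulVec, SO_transpose_mul, one_mulVec]
  intro i
  have hi := congrFun h i
  have hi' := congrFun h' i
  simp only [mulVec_single_one, col_apply, transpose_apply] at hi hi'
  rw [hi, hi']
  constructor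
  · rw [Matrix.one_apply, Pi.single_apply]; simp [eq_comm]
  · rw [Matrix.one_apply, Pi.single_apply]

theorem mulVec_single_of_mem_subSO {g : SO n} (h : g ∈ subSO n) :
    (g : Matrix (Fin n) (Fin n) ℝ) *ᵥ Pi.single 0 1 = Pi.single 0 1 := by
  ext i
  simp only [mulVec_single_one, col_apply]
  rw [(h i).2, Matrix.one_apply, Pi.single_apply]

theorem vecMul_single_of_mem_subSO {g : SO n} (h : g ∈ subSO n) :
    Pi.single 0 1 ᵥ* (g : Matrix (Fin n) (Fin n) ℝ) = Pi.single 0 1 := by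
  ext i
  rw [single_one_vecMul, row_apply, (h i).1, Matrix.one_apply, Pi.single_apply]
  simp [eq_comm]

/-- Supplies the axis of a determinant-correcting reflection; `n ≥ 3` leaves room for it in the
complement of `e₀`. -/
theorem exists_ne_zero_orthogonal (hn : 3 ≤ n) (b : Fin n → ℝ) :
    ∃ c : Fin n → ℝ, c ≠ 0 ∧ c 0 = 0 ∧ c ⬝ᵥ b = 0 := by
  set i : Fin n := ⟨1, by omega⟩
  set j : Fin n := ⟨2, by omega⟩
  have hi : (0 : Fin n) ≠ i := by simp [i, Fin.ext_iff]
  have hj : (0 : Fin n) ≠ j := by simp [j, Fin.ext_iff]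
  have hij : i ≠ j := by simp [i, j]
  by_cases hb : b i = 0
  · refine ⟨Pi.single i 1, by simp, by simp [hi], by simp [hb]⟩
  · refine ⟨Pi.single j (b i) - Pi.single i (b j), fun h => hb ?_, by simp [hi, hj], ?_⟩
    · simpa [hij, hij.symm] using congrFun h j
    · rw [sub_dotProduct, single_dotProduct, single_dotProduct]
      ring

/-- `SO(n-1)` acts transitively on the unit sphere of the orthogonal complement of `e₀`. -/
theorem exists_mem_subSO_mulVec_eq (hn : 3 ≤ n) {a b : Fin n → ℝ} (ha0 : a 0 = 0) (hb0 : b 0 = 0)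
    (hab : a ⬝ᵥ a = b ⬝ᵥ b) :
    ∃ g ∈ subSO n, (g : Matrix (Fin n) (Fin n) ℝ) *ᵥ a = b := by
  by_cases h : a = b
  · refine ⟨1, fun i => by simp, by simp [h]⟩
  obtain ⟨c, hc, hc0, hcb⟩ := exists_ne_zero_orthogonal hn b
  have hd := (dotProduct_self_pos (sub_ne_zero.2 h)).ne'
  have hc' := (dotProduct_self_pos hc).ne'
  -- The reflection along `a - b` sends `a` to `b`; the one along `c` fixes `b` and restores
  -- determinant `1`. Both fix `e₀`.
  have hmem : householder c * householder (a - b) ∈ Matrix.specialOrthogonalGroup (Fin n) ℝ := by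
    refine mem_SO_iff.2 ⟨?_, ?_⟩
    · rw [transpose_mul, mul_assoc, ← mul_assoc (householder (a - b)),
        householder_mul_transpose hd, one_mul, householder_mul_transpose hc']
    · rw [det_mul, det_householder hd, det_householder hc']
      norm_num
  refine ⟨⟨_, hmem⟩, mem_subSO_of_mulVec ?_, ?_⟩
  · rw [← mulVec_mulVec, householder_mulVec, householder_mulVec]
    simp [ha0, hb0, hc0]
  · have hcoef : 2 * ((a - b) ⬝ᵥ a) / ((a - b) ⬝ᵥ (a - b)) = 1 := by
      rw [div_eq_one_iff_eq hd]
      simp only [sub_dotProduct, dotProduct_sub, dotProduct_comm b a]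
      linarith
    rw [← mulVec_mulVec, householder_mulVec (a - b), hcoef, householder_mulVec]
    simp [hcb]

/-! ### The drift as a plane rotation. -/

section Drift

variable {A : Matrix (Fin n) (Fin n) ℝ}

theorem mPart_eq_vecMulVec (hA : A ∈ mPart n) :
    A = vecMulVec (Pi.single 0 1) (A 0) - vecMulVec (A 0) (Pi.single 0 1) := by
  have hs : ∀ i j, A j i = -A i j := fun i j => congrFun (congrFun hA.1 i) j
  ext i j
  simp only [Matrix.sub_apply, vecMulVec_apply, Pi.single_apply]
  by_cases hi : i = 0 <;> by_cases hj : j = 0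
  · subst hi; subst hj
    have := hs 0 0
    simp; linarith
  · simp [hi, hj]
  · simp [hi, hj, hs 0 i]
  · simp [hi, hj, hA.2 i j hi hj]

theorem mPart_zero_zero (hA : A ∈ mPart n) : A 0 0 = 0 := by
  have : A 0 0 = -A 0 0 := congrFun (congrFun hA.1 0) 0
  linarith

theorem mPart_sq (hA : A ∈ mPart n) :
    A * A = -((A 0 ⬝ᵥ A 0) • vecMulVec (Pi.single 0 1) (Pi.single 0 1)) -
      vecMulVec (A 0) (A 0) := by
  have h0 := mPart_zero_zero hA
  conv_lhs => rw [mPart_eq_vecMulVec hA]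
  simp only [sub_mul, mul_sub, vecMulVec_mul_vecMulVec]
  simp [h0, vecMulVec_smul]
  abel

/-- `A` is `|A 0|` times a quarter turn of the plane spanned by `e₀` and `A 0`, and vanishes on its
complement. -/
theorem mPart_cube (hA : A ∈ mPart n) : A * (A * A) = -(A 0 ⬝ᵥ A 0) • A := by
  have h0 := mPart_zero_zero hA
  rw [mPart_sq hA]
  conv_lhs => enter [1]; rw [mPart_eq_vecMulVec hA]
  conv_rhs => enter [2]; rw [mPart_eq_vecMulVec hA]
  simp only [sub_mul, mul_sub, vecMulVec_mul_vecMulVec, mul_neg, mul_smul_comm]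
  simp [h0, vecMulVec_smul, smul_sub]
  abel

open scoped Matrix.Norms.L2Operator in
theorem exp_smul_mPart (hA : A ∈ mPart n) {r : ℝ} (hr : r ≠ 0) (hr2 : A 0 ⬝ᵥ A 0 = r ^ 2) (t : ℝ) :
    NormedSpace.exp (t • A) =
      1 + (Real.sin (r * t) / r) • A + ((1 - Real.cos (r * t)) / r ^ 2) • (A * A) :=
  exp_smul_of_pow_three_eq hr (by rw [mPart_cube hA, hr2]) t

/-- A drift of minimal period `2π` has a unit vector as its first row. -/
theorem dotProduct_self_of_period (hA : A ∈ mPart n) (hper : ExpHasPeriod A (2 * Real.pi)) :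
    A 0 ⬝ᵥ A 0 = 1 := by
  have hne : A 0 ≠ 0 := by
    intro h
    have hA0 : A = 0 := by
      rw [mPart_eq_vecMulVec hA, h]
      simp
    have := hper.2 (show (1 : ℝ) ∈ _ from ⟨one_pos, fun t => by simp [hA0]⟩)
    linarith [Real.pi_gt_three]
  have hpos := dotProduct_self_pos hne
  set r := √(A 0 ⬝ᵥ A 0) with hr
  have hr0 : 0 < r := Real.sqrt_pos.2 hpos
  have hr2 : A 0 ⬝ᵥ A 0 = r ^ 2 := (Real.sq_sqrt hpos.le).symm
  have hexp := exp_smul_mPart hA hr0.ne' hr2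
  -- By Rodrigues `2π/r` is a period, so minimality gives `2π ≤ 2π/r`.
  have hle : r ≤ 1 := by
    have hmem : 2 * Real.pi / r ∈
        {S : ℝ | 0 < S ∧ Function.Periodic (fun t : ℝ => NormedSpace.exp (t • A)) S} := by
      refine ⟨by positivity, fun t => ?_⟩
      have harg : r * (t + 2 * Real.pi / r) = r * t + 2 * Real.pi := by field_simp
      simp only [hexp, harg, Real.sin_add_two_pi, Real.cos_add_two_pi]
    have := hper.2 hmem
    rw [le_div_iff₀ hr0] at this
    nlinarith [Real.pi_pos]
  -- Periodicity forces `cos(2πr) = 1`, so `r` is a positive integer.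
  have hge : 1 ≤ r := by
    have h := hper.1.2 0
    simp only [zero_add, zero_smul, NormedSpace.exp_zero, hexp, mPart_sq hA, hr2] at h
    have h00 := congrFun (congrFun h 0) 0
    simp [mPart_zero_zero hA, vecMulVec_apply] at h00
    have hcos : Real.cos (r * (2 * Real.pi)) = 1 := by
      rcases h00 with h00 | h00
      · linarith
      · exact absurd h00 hr0.ne'
    obtain ⟨k, hk⟩ := (Real.cos_eq_one_iff _).1 hcos
    have hk' : (k : ℝ) = r := mul_right_cancel₀ (by positivity) hk
    have : (0 : ℝ) < k := hk' ▸ hr0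
    have : (1 : ℤ) ≤ k := by exact_mod_cast this
    rw [← hk']
    exact_mod_cast this
  rw [hr2, le_antisymm hle hge, one_pow]

theorem exp_smul_mulVec_single (hA : A ∈ mPart n) (hunit : A 0 ⬝ᵥ A 0 = 1) (t : ℝ) :
    NormedSpace.exp (t • A) *ᵥ Pi.single 0 1 =
      Real.cos t • Pi.single 0 1 - Real.sin t • A 0 := by
  rw [exp_smul_mPart hA one_ne_zero (by rw [hunit, one_pow]), mPart_sq hA, hunit]
  conv_lhs => enter [1, 1, 2, 2]; rw [mPart_eq_vecMulVec hA]
  have h0 := mPart_zero_zero hA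
  simp only [add_mulVec, sub_mulVec, smul_mulVec, vecMulVec_mulVec, neg_mulVec, one_mulVec]
  simp [h0]
  module

end Drift

/-! ### The decomposition `K exp(β Ω_d) K`. -/

section Decomposition

variable {A : Matrix (Fin n) (Fin n) ℝ} {g : SO n} {β : ℝ}

theorem HasDecomposition.apply_zero_zero (hA : A ∈ mPart n) (hunit : A 0 ⬝ᵥ A 0 = 1)
    (h : HasDecomposition (subSO n) A g β) :
    (g : Matrix (Fin n) (Fin n) ℝ) 0 0 = Real.cos β := by
  obtain ⟨g₁, h₁, g₂, h₂, hg⟩ := h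
  have : (g : Matrix (Fin n) (Fin n) ℝ) 0 0 = Pi.single 0 1 ⬝ᵥ (g.1 *ᵥ Pi.single 0 1) := by simp
  rw [this, hg, ← mulVec_mulVec, ← mulVec_mulVec, mulVec_single_of_mem_subSO h₂,
    exp_smul_mulVec_single hA hunit, dotProduct_mulVec, vecMul_single_of_mem_subSO h₁]
  simp [mPart_zero_zero hA]

theorem exists_hasDecomposition (hn : 3 ≤ n) (hA : A ∈ mPart n) (hunit : A 0 ⬝ᵥ A 0 = 1)
    (g : SO n) : ∃ β ∈ Set.Icc 0 Real.pi, HasDecomposition (subSO n) A g β := by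
  set x : Fin n → ℝ := g.1 *ᵥ Pi.single 0 1 with hx
  have hxx : x ⬝ᵥ x = 1 := by
    rw [hx, dotProduct_mulVec, vecMul_mulVec, SO_transpose_mul]
    simp
  have hsum : x 0 ^ 2 ≤ 1 := by
    rw [← hxx, sq]
    exact Finset.single_le_sum (f := fun i => x i * x i) (fun i _ => mul_self_nonneg _)
      (Finset.mem_univ 0)
  have habs := abs_le.1 ((sq_le_one_iff_abs_le_one _).1 hsum)
  set β := Real.arccos (x 0) with hβ
  have hcos : Real.cos β = x 0 := Real.cos_arccos habs.1 habs.2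
  have h0 := mPart_zero_zero hA
  -- With this `β`, `exp(β A) e₀` and `g e₀` have the same `e₀` component; `k` matches the rest, so
  -- `(k E)⁻¹ g` fixes `e₀`.
  obtain ⟨k, hk, hkx⟩ := exists_mem_subSO_mulVec_eq hn
    (a := -(Real.sin β • A 0)) (b := x - Real.cos β • Pi.single 0 1) (by simp [h0])
    (by simp [hcos]) (by
      have := Real.sin_sq_add_cos_sq β
      simp [dotProduct_sub, sub_dotProduct, hunit, hxx, ← hcos]
      linarith)
  set E : SO n := expSO (β • A) (smul_skew hA.1 β) with hE
  refine ⟨β, ⟨Real.arccos_nonneg _, Real.arccos_le_pi _⟩, k, hk, (k * E)⁻¹ * g, ?_, ?_⟩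
  · have hkE : (k.1 * E.1) *ᵥ Pi.single 0 1 = x := by
      rw [← mulVec_mulVec]
      change k.1 *ᵥ (NormedSpace.exp (β • A) *ᵥ _) = x
      rw [exp_smul_mulVec_single hA hunit, sub_eq_add_neg, mulVec_add, hkx, mulVec_smul,
        mulVec_single_of_mem_subSO hk]
      abel
    apply mem_subSO_of_mulVec
    change ((k * E)⁻¹.1 * g.1) *ᵥ _ = _
    rw [← mulVec_mulVec, ← hx, ← hkE, mulVec_mulVec]
    change ((k * E)⁻¹.1 * (k * E).1) *ᵥ _ = _
    rw [SO_coe_inv, SO_transpose_mul, one_mulVec]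
  · have : g = k * E * ((k * E)⁻¹ * g) := by group
    exact congrArg Subtype.val this

theorem existsUnique_hasDecomposition (hn : 3 ≤ n) (hA : A ∈ mPart n) (hunit : A 0 ⬝ᵥ A 0 = 1)
    (g : SO n) : ∃! β : ℝ, β ∈ Set.Icc 0 Real.pi ∧ HasDecomposition (subSO n) A g β := by
  obtain ⟨β, hβ, hg⟩ := exists_hasDecomposition hn hA hunit g
  refine ⟨β, ⟨hβ, hg⟩, fun γ ⟨hγ, hg'⟩ => ?_⟩
  exact Real.injOn_cos hγ hβ
    ((hg'.apply_zero_zero hA hunit).symm.trans (hg.apply_zero_zero hA hunit))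

end Decomposition

end SOControl

namespace SOControl

open scoped Matrix
open Matrix Filter Topology MeasureTheory

attribute [local instance] LieRing.ofAssociativeRing

/-! ### One-parameter subgroups of a closed subgroup. -/

section ClosedSubgroups

variable {n : ℕ}

open scoped Matrix.Norms.L2Operator in
-- The Lie product formula; it makes generators closed under addition.
theorem tendsto_exp_mul_exp_pow {X Y : Matrix (Fin n) (Fin n) ℝ} (hX : Xᵀ = -X) (hY : Yᵀ = -Y) :
    Tendsto (fun k : ℕ => (NormedSpace.exp ((1 / ((k : ℝ) + 1)) • X) *
      NormedSpace.exp ((1 / ((k : ℝ) + 1)) • Y)) ^ (k + 1)) atTop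
      (𝓝 (NormedSpace.exp (X + Y))) := by
  have hXY : (X + Y)ᵀ = -(X + Y) := by rw [transpose_add, hX, hY]; abel
  have h : HasDerivAt (fun t : ℝ => NormedSpace.exp (t • X) * NormedSpace.exp (t • Y))
      (X + Y) 0 := by
    simpa using! (hasDerivAt_exp_smul_const (𝕂 := ℝ) X (0 : ℝ)).mul
      (hasDerivAt_exp_smul_const (𝕂 := ℝ) Y (0 : ℝ))
  have h1 : ∀ t : ℝ, ‖NormedSpace.exp (t • X) * NormedSpace.exp (t • Y)‖ ≤ 1 := fun t =>
    norm_le_one_of_mem_SO (mul_mem (exp_mem_SO (smul_skew hX t)) (exp_mem_SO (smul_skew hY t)))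
  have h2 : ∀ t : ℝ, ‖NormedSpace.exp (t • (X + Y))‖ ≤ 1 := fun t =>
    norm_le_one_of_mem_SO (exp_mem_SO (smul_skew hXY t))
  have h0 : ‖(1 : Matrix (Fin n) (Fin n) ℝ)‖ ≤ 1 :=
    norm_le_one_of_mem_SO (one_mem (Matrix.specialOrthogonalGroup (Fin n) ℝ))
  have hlim := tendsto_pow_exp_of_hasDerivAt h0 h (by simp) h1 h2
  exact hlim

open scoped Matrix.Norms.L2Operator in
theorem tendsto_conj_exp_sub (X Y : Matrix (Fin n) (Fin n) ℝ) :
    Tendsto (fun t : ℝ => t⁻¹ • (NormedSpace.exp (t • X) * Y * NormedSpace.exp (t • -X) - Y))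
      (𝓝[≠] 0) (𝓝 (X * Y - Y * X)) := by
  have h := ((hasDerivAt_exp_smul_const (𝕂 := ℝ) X (0 : ℝ)).mul_const Y).mul
    (hasDerivAt_exp_smul_const (𝕂 := ℝ) (-X) (0 : ℝ))
  have h' := hasDerivAt_iff_tendsto_slope_zero.1 h
  simpa [sub_eq_add_neg] using h'

open scoped Matrix.Norms.L2Operator in
theorem continuous_matrix_exp :
    Continuous (fun X : Matrix (Fin n) (Fin n) ℝ => NormedSpace.exp X) := by
  let _ : NormedAlgebra ℚ (Matrix (Fin n) (Fin n) ℝ) := NormedAlgebra.restrictScalars ℚ ℝ _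
  exact NormedSpace.exp_continuous

/-- `X` is skew-symmetric and generates a one-parameter subgroup contained in `H`. -/
def IsTangent (H : Subgroup (SO n)) (X : Matrix (Fin n) (Fin n) ℝ) : Prop :=
  Xᵀ = -X ∧ ∀ t : ℝ, ∃ g ∈ H, (g : Matrix (Fin n) (Fin n) ℝ) = NormedSpace.exp (t • X)

variable {H : Subgroup (SO n)} {X Y : Matrix (Fin n) (Fin n) ℝ}

theorem mem_of_tendsto_val (hH : IsClosed (H : Set (SO n))) {u : ℕ → SO n}
    (hu : ∀ k, u k ∈ H) {A : Matrix (Fin n) (Fin n) ℝ}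
    (hA : A ∈ Matrix.specialOrthogonalGroup (Fin n) ℝ)
    (hlim : Tendsto (fun k => (u k : Matrix (Fin n) (Fin n) ℝ)) atTop (𝓝 A)) :
    (⟨A, hA⟩ : SO n) ∈ H :=
  hH.mem_of_tendsto (tendsto_subtype_rng.2 hlim) (Eventually.of_forall hu)

theorem IsTangent.smul (hX : IsTangent H X) (c : ℝ) : IsTangent H (c • X) := by
  refine ⟨smul_skew hX.1 c, fun t => ?_⟩
  rw [smul_smul]
  exact hX.2 _

theorem IsTangent.add (hH : IsClosed (H : Set (SO n))) (hX : IsTangent H X)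
    (hY : IsTangent H Y) : IsTangent H (X + Y) := by
  have hXY : (X + Y)ᵀ = -(X + Y) := by rw [transpose_add, hX.1, hY.1]; abel
  refine ⟨hXY, fun t => ⟨⟨_, exp_mem_SO (smul_skew hXY t)⟩, ?_, rfl⟩⟩
  choose gX hgX hgX' using (hX.smul t).2
  choose gY hgY hgY' using (hY.smul t).2
  refine mem_of_tendsto_val hH
    (u := fun k => (gX (1 / ((k : ℝ) + 1)) * gY (1 / ((k : ℝ) + 1))) ^ (k + 1))
    (fun k => H.pow_mem (H.mul_mem (hgX _) (hgY _)) _) _ ?_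
  have h := tendsto_exp_mul_exp_pow (smul_skew hX.1 t) (smul_skew hY.1 t)
  rw [smul_add]
  simpa only [SubmonoidClass.coe_pow, Submonoid.coe_mul, hgX', hgY'] using h

theorem IsTangent.conj (hY : IsTangent H Y) {g : SO n} (hg : g ∈ H) :
    IsTangent H (g.1 * Y * (g⁻¹).1) := by
  have hinv : (g⁻¹).1 = (g.1)⁻¹ := (Matrix.inv_eq_right_inv (SO_mul_transpose g)).symm
  have hunit : IsUnit g.1 := IsUnit.of_mul_eq_one _ (SO_mul_transpose g)
  refine ⟨?_, fun t => ?_⟩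
  · rw [SO_coe_inv, transpose_mul, transpose_mul, transpose_transpose, hY.1]
    noncomm_ring
  · obtain ⟨h, hh, hh'⟩ := hY.2 t
    refine ⟨g * h * g⁻¹, H.mul_mem (H.mul_mem hg hh) (H.inv_mem hg), ?_⟩
    change g.1 * h.1 * (g⁻¹).1 = _
    rw [hh', hinv, ← Matrix.exp_conj _ _ hunit, mul_smul_comm, smul_mul_assoc]

theorem IsTangent.of_tendsto (hH : IsClosed (H : Set (SO n)))
    {u : ℕ → Matrix (Fin n) (Fin n) ℝ} (hu : ∀ k, IsTangent H (u k))
    (hlim : Tendsto u atTop (𝓝 X)) : IsTangent H X := by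
  have hX : Xᵀ = -X := by
    refine tendsto_nhds_unique
      ((continuous_id.matrix_transpose.tendsto X).comp hlim) ?_
    refine hlim.neg.congr fun k => ?_
    exact (hu k).1.symm
  refine ⟨hX, fun t => ⟨⟨_, exp_mem_SO (smul_skew hX t)⟩, ?_, rfl⟩⟩
  choose g hg hg' using fun k => (hu k).2 t
  refine mem_of_tendsto_val hH hg _ ?_
  simp only [hg']
  exact (continuous_matrix_exp.tendsto _).comp (hlim.const_smul t)

/-- The commutator is a limit of difference quotients of conjugates of `Y`, each tangent by
`IsTangent.conj` and `IsTangent.add`. -/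
theorem IsTangent.commutator (hH : IsClosed (H : Set (SO n))) (hX : IsTangent H X)
    (hY : IsTangent H Y) : IsTangent H (X * Y - Y * X) := by
  have hseq : Tendsto (fun k : ℕ => 1 / ((k : ℝ) + 1)) atTop (𝓝[≠] 0) :=
    tendsto_nhdsWithin_iff.2 ⟨tendsto_one_div_add_atTop_nhds_zero_nat,
      Eventually.of_forall fun k => (Nat.one_div_pos_of_nat (α := ℝ)).ne'⟩
  refine IsTangent.of_tendsto hH (fun k => ?_) ((tendsto_conj_exp_sub X Y).comp hseq)
  obtain ⟨g, hg, hg'⟩ := hX.2 (1 / ((k : ℝ) + 1))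
  have hginv : (g⁻¹).1 = NormedSpace.exp ((1 / ((k : ℝ) + 1)) • -X) := by
    rw [SO_coe_inv, hg', ← Matrix.exp_transpose, transpose_smul, hX.1]
  have h := ((hY.conj hg).add hH (hY.smul (-1))).smul (1 / ((k : ℝ) + 1))⁻¹
  rw [hginv, hg', neg_one_smul, ← sub_eq_add_neg] at h
  exact h

/-- One-parameter subgroups of a closed subgroup: their generators form a Lie algebra. -/
theorem isTangent_of_mem_lieSpan (hH : IsClosed (H : Set (SO n)))
    {s : Set (Matrix (Fin n) (Fin n) ℝ)} (hs : ∀ X ∈ s, IsTangent H X)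
    (hX : X ∈ LieSubalgebra.lieSpan ℝ (Matrix (Fin n) (Fin n) ℝ) s) : IsTangent H X := by
  let L : LieSubalgebra ℝ (Matrix (Fin n) (Fin n) ℝ) :=
    { carrier := {X | IsTangent H X}
      add_mem' := fun hX hY => IsTangent.add hH hX hY
      zero_mem' := ⟨by simp, fun t => ⟨1, H.one_mem, by simp⟩⟩
      smul_mem' := fun c _ hX => IsTangent.smul hX c
      lie_mem' := fun hX hY => IsTangent.commutator hH hX hY }
  exact (LieSubalgebra.lieSpan_le (K := L)).2 hs hX

end ClosedSubgroups

/-! ### Reachable sets and the upper bound. -/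

section Trajectories

variable {n m : ℕ} {Ωd : Matrix (Fin n) (Fin n) ℝ} {Ω : Fin m → Matrix (Fin n) (Fin n) ℝ}

theorem continuousOn_entry {U : ℝ → SO n} {s : Set ℝ} (hU : ContinuousOn U s) (i j : Fin n) :
    ContinuousOn (fun t => (U t : Matrix (Fin n) (Fin n) ℝ) i j) s :=
  (continuous_subtype_val.matrix_elem i j).comp_continuousOn hU

theorem intervalIntegrable_of_isControl {v : ℝ → Fin m → ℝ} (hv : IsControl v) (k : Fin m)
    {t : ℝ} (ht : 0 ≤ t) : IntervalIntegrable (fun s => v s k) volume 0 t := by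
  obtain ⟨C, hC⟩ := hv.2 t
  rw [intervalIntegrable_iff_integrableOn_Icc_of_le ht]
  refine Measure.integrableOn_of_bounded (M := C) (by simp)
    ((measurable_pi_apply k).comp hv.1).aestronglyMeasurable ?_
  exact (ae_restrict_iff' measurableSet_Icc).2 (Eventually.of_forall fun s hs => hC s hs k)

theorem intervalIntegrable_velocity {v : ℝ → Fin m → ℝ} (hv : IsControl v) {U : ℝ → SO n}
    (hU : ContinuousOn U (Set.Ici 0)) (i j : Fin n) {t : ℝ} (ht : 0 ≤ t) :
    IntervalIntegrable
      (fun s => ((Ωd + ∑ k, v s k • Ω k) * (U s : Matrix (Fin n) (Fin n) ℝ)) i j) volume 0 t := by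
  simp only [Matrix.mul_apply, Matrix.add_apply, Matrix.sum_apply, Matrix.smul_apply, smul_eq_mul]
  have hsum : ∀ l : Fin n,
      IntervalIntegrable (fun s => Ωd i l + ∑ k, v s k * Ω k i l) volume 0 t := fun l =>
    intervalIntegrable_const.add (by
      simpa [Finset.sum_fn] using IntervalIntegrable.sum Finset.univ fun k _ =>
        (intervalIntegrable_of_isControl hv k ht).mul_const (Ω k i l))
  simpa [Finset.sum_fn] using IntervalIntegrable.sum Finset.univ fun l _ =>
    (hsum l).mul_continuousOn ((continuousOn_entry hU l j).mono (by
      rw [Set.uIcc_of_le ht]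
      exact Set.Icc_subset_Ici_self))

open scoped Matrix.Norms.L2Operator in
theorem hasDerivAt_exp_smul_entry (A : Matrix (Fin n) (Fin n) ℝ) (i j : Fin n) (t : ℝ) :
    HasDerivAt (fun t : ℝ => NormedSpace.exp (t • A) i j) ((A * NormedSpace.exp (t • A)) i j) t :=
  (LinearMap.toContinuousLinearMap
    (Matrix.entryLinearMap ℝ ℝ i j)).hasFDerivAt.comp_hasDerivAt t
      (hasDerivAt_exp_smul_const' (𝕂 := ℝ) A t)

theorem exp_mem_reachableAt (c : Fin m → ℝ) (hA : (Ωd + ∑ k, c k • Ω k)ᵀ = -(Ωd + ∑ k, c k • Ω k))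
    (t : ℝ) : expSO (t • (Ωd + ∑ k, c k • Ω k)) (smul_skew hA t) ∈ reachableAt Ωd Ω t := by
  set A := Ωd + ∑ k, c k • Ω k
  have hcont : Continuous fun s : ℝ => NormedSpace.exp (s • A) :=
    continuous_matrix_exp.comp (continuous_id.smul continuous_const)
  refine ⟨fun _ => c, fun s => expSO (s • A) (smul_skew hA s), ⟨measurable_const, fun T => ?_⟩,
    ⟨?_, fun s _ i j => ?_⟩, rfl⟩
  · exact ⟨∑ k, |c k|, fun t _ k =>
      Finset.single_le_sum (f := fun k => |c k|) (fun _ _ => abs_nonneg _) (Finset.mem_univ k)⟩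
  · exact (Continuous.subtype_mk hcont _).continuousOn
  · have hint : Continuous fun s : ℝ => (A * NormedSpace.exp (s • A)) i j :=
      (continuous_const.matrix_mul hcont).matrix_elem i j
    have h := intervalIntegral.integral_eq_sub_of_hasDerivAt (a := 0) (b := s)
      (fun x _ => hasDerivAt_exp_smul_entry A i j x) (hint.intervalIntegrable _ _)
    change NormedSpace.exp (s • A) i j = (1 : Matrix (Fin n) (Fin n) ℝ) i j +
      ∫ x in (0 : ℝ)..s, (A * NormedSpace.exp (x • A)) i j
    rw [h]
    simp

theorem one_mem_reachableAt_zero (hd : Ωdᵀ = -Ωd) : (1 : SO n) ∈ reachableAt Ωd Ω 0 := by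
  have h := exp_mem_reachableAt (Ωd := Ωd) (Ω := Ω) 0 (by simpa using hd) 0
  convert h using 1
  exact Subtype.ext (by simp [expSO])

/-- The system is right invariant: reachable points multiply by concatenating controls. -/
theorem mul_mem_reachableAt {g h : SO n} {s t : ℝ} (hs : 0 ≤ s) (ht : 0 ≤ t)
    (hg : g ∈ reachableAt Ωd Ω s) (hh : h ∈ reachableAt Ωd Ω t) :
    h * g ∈ reachableAt Ωd Ω (s + t) := by
  obtain ⟨v, U, hv, ⟨hUc, hU⟩, rfl⟩ := hg
  obtain ⟨w, V, hw, ⟨hVc, hV⟩, rfl⟩ := hh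
  have hV0 : V 0 = 1 := Subtype.ext (by ext i j; simpa using hV 0 le_rfl i j)
  -- By right invariance the second trajectory may be restarted from `U s`; the pieces agree at time
  -- `s` because `V 0 = 1`.
  set W : ℝ → SO n := fun x => if x ≤ s then U x else V (x - s) * U s with hW
  have hWle : ∀ x ≤ s, W x = U x := fun x hx => if_pos hx
  have hWge : ∀ x, s ≤ x → W x = V (x - s) * U s := by
    intro x hx
    rcases hx.eq_or_lt with rfl | hx
    · simp [hW, hV0]
    · exact if_neg hx.not_ge
  set z : ℝ → Fin m → ℝ := fun x => if x ≤ s then v x else w (x - s) with hz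
  have hzc : IsControl z := by
    refine ⟨Measurable.ite measurableSet_Iic hv.1 (hw.1.comp (measurable_id.sub_const s)),
      fun T => ?_⟩
    obtain ⟨C, hC⟩ := hv.2 T
    obtain ⟨D, hD⟩ := hw.2 T
    refine ⟨max C D, fun x hx k => ?_⟩
    by_cases hxs : x ≤ s
    · simp only [hz, hxs, if_true]
      exact (hC x hx k).trans (le_max_left _ _)
    · simp only [hz, hxs, if_false]
      have := hx.2
      exact (hD (x - s) ⟨by linarith, by linarith⟩ k).trans (le_max_right _ _)
  have hWc : ContinuousOn W (Set.Ici 0) := by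
    have h1 : ContinuousOn W (Set.Icc 0 s) :=
      (hUc.mono Set.Icc_subset_Ici_self).congr fun x hx => hWle x hx.2
    have h2 : ContinuousOn W (Set.Ici s) := by
      have : ContinuousOn (fun x => V (x - s) * U s) (Set.Ici s) :=
        ContinuousOn.mul (f := fun x => V (x - s)) (g := fun _ => U s)
          (hVc.comp (continuous_sub_right s).continuousOn
            fun x hx => Set.mem_Ici.2 (sub_nonneg.2 hx)) continuousOn_const
      exact this.congr fun x hx => hWge x hx
    have := h1.union_of_isClosed h2 isClosed_Icc isClosed_Ici
    rwa [Set.Icc_union_Ici_eq_Ici hs] at this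
  refine ⟨z, W, hzc, ⟨hWc, fun x hx i j => ?_⟩, by rw [hWge _ (by linarith), add_sub_cancel_left]⟩
  have hle : ∀ y, 0 ≤ y → y ≤ s → (W y).1 i j = (1 : Matrix (Fin n) (Fin n) ℝ) i j +
      ∫ x in (0 : ℝ)..y, ((Ωd + ∑ k, z x k • Ω k) * (W x).1) i j := by
    intro y hy hys
    rw [hWle y hys, hU y hy]
    congr 1
    refine intervalIntegral.integral_congr fun x hx => ?_
    rw [Set.uIcc_of_le hy] at hx
    have hxs : x ≤ s := hx.2.trans hys
    simp only [hz, hWle x hxs, hxs, if_true]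
  rcases le_total x s with hxs | hxs
  · exact hle x hx hxs
  have hint := fun {y : ℝ} (hy : 0 ≤ y) =>
    intervalIntegrable_velocity (Ωd := Ωd) (Ω := Ω) hzc hWc i j hy
  have hy : 0 ≤ x - s := sub_nonneg.2 hxs
  rw [← intervalIntegral.integral_add_adjacent_intervals (hint hs) ((hint hs).symm.trans (hint hx)),
    ← add_assoc, ← hle s hs le_rfl, hWle s le_rfl, hWge x hxs]
  have htail : ∫ y in s..x, ((Ωd + ∑ k, z y k • Ω k) * (W y).1) i j =
      ∫ y in s..x, ((Ωd + ∑ k, w (y - s) k • Ω k) * (V (y - s) * U s : SO n).1) i j := by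
    refine intervalIntegral.integral_congr_ae (Eventually.of_forall fun y hy => ?_)
    rw [Set.uIoc_of_le hxs] at hy
    simp only [hz, hWge y hy.1.le, hy.1.not_ge, if_false]
  rw [htail, intervalIntegral.integral_comp_sub_right
    (fun y => ((Ωd + ∑ k, w y k • Ω k) * (V y * U s : SO n).1) i j) s, sub_self]
  have hentry : ∀ y, ((Ωd + ∑ k, w y k • Ω k) * (V y * U s : SO n).1) i j =
      ∑ l, ((Ωd + ∑ k, w y k • Ω k) * (V y).1) i l * (U s).1 l j := by
    intro y
    change ((Ωd + ∑ k, w y k • Ω k) * ((V y).1 * (U s).1)) i j = _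
    rw [← mul_assoc, Matrix.mul_apply]
  simp only [hentry]
  rw [intervalIntegral.integral_finsetSum fun l _ =>
    (intervalIntegrable_velocity hw hVc i l hy).mul_const _]
  simp only [intervalIntegral.integral_mul_const]
  change ((V (x - s)).1 * (U s).1) i j = _
  rw [Matrix.mul_apply]
  simp only [hV (x - s) hy, add_mul, Finset.sum_add_distrib]
  congr 1
  rw [← Matrix.mul_apply, one_mul]

theorem reachableAt_subset_reachableWithin {t : ℝ} (ht : 0 ≤ t) :
    reachableAt Ωd Ω t ⊆ reachableWithin Ωd Ω t :=
  Set.subset_biUnion_of_mem (u := fun t => reachableAt Ωd Ω t) ⟨ht, le_rfl⟩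

theorem mul_mem_closure_reachableWithin {g h : SO n} {s t : ℝ}
    (hg : g ∈ closure (reachableWithin Ωd Ω s)) (hh : h ∈ closure (reachableWithin Ωd Ω t)) :
    h * g ∈ closure (reachableWithin Ωd Ω (s + t)) := by
  refine map_mem_closure₂ continuous_mul hh hg fun a ha b hb => ?_
  simp only [reachableWithin, Set.mem_iUnion] at ha hb ⊢
  obtain ⟨x, hx, ha⟩ := ha
  obtain ⟨y, hy, hb⟩ := hb
  exact ⟨y + x, ⟨add_nonneg hy.1 hx.1, add_le_add hy.2 hx.2⟩, mul_mem_reachableAt hy.1 hx.1 hb ha⟩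

/-- The elements that, together with their inverses, can be approximated in arbitrarily
short time. -/
def instantSubgroup (Ωd : Matrix (Fin n) (Fin n) ℝ) (Ω : Fin m → Matrix (Fin n) (Fin n) ℝ)
    (hd : Ωdᵀ = -Ωd) : Subgroup (SO n) where
  -- Inverses are imposed because concatenation alone gives only a semigroup.
  carrier := {g | ∀ ε > 0, g ∈ closure (reachableWithin Ωd Ω ε) ∧
    g⁻¹ ∈ closure (reachableWithin Ωd Ω ε)}
  one_mem' := by
    intro ε hε
    have h : (1 : SO n) ∈ closure (reachableWithin Ωd Ω ε) := subset_closure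
      (Set.mem_biUnion (Set.left_mem_Icc.2 (le_of_lt hε)) (one_mem_reachableAt_zero hd))
    exact ⟨h, by rwa [inv_one]⟩
  mul_mem' := by
    intro a b ha hb ε hε
    have ha' := ha (ε / 2) (half_pos hε)
    have hb' := hb (ε / 2) (half_pos hε)
    rw [← add_halves ε, _root_.mul_inv_rev]
    exact ⟨mul_mem_closure_reachableWithin hb'.1 ha'.1,
      mul_mem_closure_reachableWithin ha'.2 hb'.2⟩
  inv_mem' := by
    intro a ha ε hε
    rw [inv_inv]
    exact (ha ε hε).symm

theorem isClosed_instantSubgroup (hd : Ωdᵀ = -Ωd) :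
    IsClosed (instantSubgroup Ωd Ω hd : Set (SO n)) := by
  have : (instantSubgroup Ωd Ω hd : Set (SO n)) = ⋂ ε > 0,
      (closure (reachableWithin Ωd Ω ε) ∩ (fun g => g⁻¹) ⁻¹' closure (reachableWithin Ωd Ω ε)) := by
    ext g
    simp [instantSubgroup]
  rw [this]
  exact isClosed_biInter fun ε _ =>
    isClosed_closure.inter (isClosed_closure.preimage continuous_SO_inv)

/-- The constant control `t/δ` over time `δ` reaches `exp(δ Ω_d + t Ω_k)`; let `δ → 0`. -/
theorem exp_smul_mem_closure_reachableWithin (hd : Ωdᵀ = -Ωd) (hΩ : ∀ k, (Ω k)ᵀ = -Ω k)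
    (k : Fin m) (t : ℝ) {ε : ℝ} (hε : 0 < ε) :
    expSO (t • Ω k) (smul_skew (hΩ k) t) ∈ closure (reachableWithin Ωd Ω ε) := by
  have hskew : ∀ δ : ℝ, (δ • Ωd + t • Ω k)ᵀ = -(δ • Ωd + t • Ω k) := by
    intro δ
    rw [transpose_add, smul_skew hd, smul_skew (hΩ k)]
    abel
  have hcont : Continuous fun δ : ℝ => expSO (δ • Ωd + t • Ω k) (hskew δ) :=
    Continuous.subtype_mk (continuous_matrix_exp.comp
      ((continuous_id.smul continuous_const).add continuous_const)) _
  have hlim : Tendsto (fun δ : ℝ => expSO (δ • Ωd + t • Ω k) (hskew δ)) (𝓝[>] 0)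
      (𝓝 (expSO (t • Ω k) (smul_skew (hΩ k) t))) := by
    have := (hcont.tendsto 0).mono_left (nhdsWithin_le_nhds (s := Set.Ioi 0))
    simpa using this
  refine mem_closure_of_tendsto hlim ?_
  filter_upwards [Ioo_mem_nhdsGT hε] with δ hδ
  have hsum : δ • (Ωd + ∑ l, (Pi.single k (t / δ) : Fin m → ℝ) l • Ω l) = δ • Ωd + t • Ω k := by
    rw [Finset.sum_eq_single k (fun l _ hl => by simp [hl]) (by simp), Pi.single_eq_same,
      smul_add, smul_smul, mul_div_cancel₀ t hδ.1.ne']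
  have hA : (Ωd + ∑ l, (Pi.single k (t / δ) : Fin m → ℝ) l • Ω l)ᵀ =
      -(Ωd + ∑ l, (Pi.single k (t / δ) : Fin m → ℝ) l • Ω l) := by
    rw [transpose_add, transpose_sum, hd, neg_add, ← Finset.sum_neg_distrib]
    simp only [smul_skew (hΩ _)]
  have h := exp_mem_reachableAt _ hA δ
  simp only [hsum] at h
  exact Set.mem_biUnion (Set.mem_Icc.2 ⟨hδ.1.le, hδ.2.le⟩) h

/-- The instant subgroup is closed and contains each `exp(t Ω_k)`, so its generators include the
whole Lie span. -/
theorem controlGroup_subset_instantSubgroup (hd : Ωdᵀ = -Ωd) (hΩ : ∀ k, (Ω k)ᵀ = -Ω k) :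
    controlGroup Ω ⊆ instantSubgroup Ωd Ω hd := by
  refine closure_minimal ?_ (isClosed_instantSubgroup hd)
  refine (Subgroup.closure_le _).2 ?_
  rintro g ⟨X, hX, hg⟩
  have htangent := isTangent_of_mem_lieSpan (isClosed_instantSubgroup (Ω := Ω) hd) (X := X) ?_ hX
  · obtain ⟨h, hh, hh'⟩ := htangent.2 1
    rw [one_smul, ← hg] at hh'
    rwa [← Subtype.ext hh']
  · rintro _ ⟨k, rfl⟩
    refine ⟨hΩ k, fun t => ⟨expSO (t • Ω k) (smul_skew (hΩ k) t), fun ε hε => ⟨?_, ?_⟩, rfl⟩⟩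
    · exact exp_smul_mem_closure_reachableWithin hd hΩ k t hε
    · have hinv : (expSO (t • Ω k) (smul_skew (hΩ k) t))⁻¹ =
          expSO (-t • Ω k) (smul_skew (hΩ k) (-t)) := by
        refine Subtype.ext ?_
        rw [SO_coe_inv]
        change (NormedSpace.exp _)ᵀ = NormedSpace.exp _
        rw [← Matrix.exp_transpose, smul_skew (hΩ k), neg_smul]
      rw [hinv]
      exact exp_smul_mem_closure_reachableWithin hd hΩ k (-t) hε

theorem mem_closure_reachableWithin_of_hasDecomposition (hd : Ωdᵀ = -Ωd)
    (hΩ : ∀ k, (Ω k)ᵀ = -Ω k) {g : SO n} {β : ℝ} (hβ : 0 ≤ β)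
    (hg : HasDecomposition (controlGroup Ω) Ωd g β) {ε : ℝ} (hε : 0 < ε) :
    g ∈ closure (reachableWithin Ωd Ω (β + ε)) := by
  obtain ⟨g₁, h₁, g₂, h₂, hg⟩ := hg
  have hE : expSO (β • Ωd) (smul_skew hd β) ∈ closure (reachableWithin Ωd Ω β) := by
    have h := exp_mem_reachableAt (Ωd := Ωd) (Ω := Ω) 0 (by simpa using hd) β
    simp only [Pi.zero_apply, zero_smul, Finset.sum_const_zero, add_zero] at h
    exact subset_closure (reachableAt_subset_reachableWithin hβ h)
  have hsub := controlGroup_subset_instantSubgroup hd hΩ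
  have h := mul_mem_closure_reachableWithin
    (mul_mem_closure_reachableWithin (hsub h₂ (ε / 2) (half_pos hε)).1 hE)
    (hsub h₁ (ε / 2) (half_pos hε)).1
  have hg' : g = g₁ * (expSO (β • Ωd) (smul_skew hd β) * g₂) := by
    rw [← mul_assoc]
    exact Subtype.ext hg
  rw [hg']
  convert h using 3
  ring

/-! ### The lower bound on the time. -/

variable [NeZero n]

/-- The first diagonal entry of a trajectory decreases at most as fast as the cosine. -/
theorem cos_le_apply_zero_zero (hd : Ωd ∈ mPart n) (hΩ : ∀ k, Ω k ∈ kPart n)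
    (hunit : Ωd 0 ⬝ᵥ Ωd 0 = 1) {v : ℝ → Fin m → ℝ} {U : ℝ → SO n}
    (hU : IsTrajectory Ωd Ω v U) {t : ℝ} (ht : 0 ≤ t) (htpi : t < Real.pi) :
    Real.cos t ≤ (U t).1 0 0 := by
  -- The first rows of the `Ω_k` vanish, so this velocity is continuous though the controls are only
  -- measurable; `max 0 s` extends it to all of `ℝ`.
  set ψ : ℝ → ℝ := fun s => Ωd 0 ⬝ᵥ fun l => (U (max 0 s)).1 l 0 with hψ
  have hψc : Continuous ψ := by
    refine continuous_finsetSum _ fun l _ => continuous_const.mul ?_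
    exact (continuousOn_entry hU.1 l 0).comp_continuous (continuous_const.max continuous_id)
      fun s => Set.mem_Ici.2 (le_max_left _ _)
  set f : ℝ → ℝ := fun s => 1 + ∫ x in (0 : ℝ)..s, ψ x with hf
  have hfU : ∀ s, 0 ≤ s → (U s).1 0 0 = f s := by
    intro s hs
    rw [hU.2 s hs, Matrix.one_apply_eq, hf]
    congr 1
    refine intervalIntegral.integral_congr fun x hx => ?_
    rw [Set.uIcc_of_le hs] at hx
    simp only [hψ, max_eq_right hx.1, Matrix.mul_apply, dotProduct]
    refine Finset.sum_congr rfl fun l _ => ?_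
    simp [Matrix.add_apply, Matrix.sum_apply, ((hΩ _).2 l).1]
  have hf' : ∀ s, HasDerivAt f (ψ s) s := fun s =>
    (intervalIntegral.integral_hasDerivAt_right (hψc.intervalIntegrable _ _)
      (hψc.stronglyMeasurableAtFilter _ _) hψc.continuousAt).const_add 1
  rw [hfU t ht]
  refine cos_le_of_neg_sqrt_le_deriv htpi (fun s _ => (hf' s).continuousAt.continuousWithinAt)
    (fun s _ => (hf' s).hasDerivWithinAt) (by simp [hf]) (fun s hs => ?_) ht
  refine (abs_le.1 (Real.abs_le_sqrt ?_)).1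
  rw [← hfU s hs.1]
  simp only [hψ, max_eq_right hs.1]
  set x : Fin n → ℝ := fun l => (U s).1 l 0 with hx
  have hxx : x ⬝ᵥ x = 1 := by
    have := congrFun (congrFun (SO_transpose_mul (U s)) 0) 0
    simpa [Matrix.mul_apply, dotProduct, hx] using this
  -- Dropping the `e₀` component before Cauchy–Schwarz sharpens the bound from `1` to `1 - x 0 ^ 2`.
  have hproj : Ωd 0 ⬝ᵥ x = Ωd 0 ⬝ᵥ (x - x 0 • Pi.single 0 1) := by
    simp [dotProduct_sub, mPart_zero_zero hd]
  have hnorm : (x - x 0 • Pi.single 0 1) ⬝ᵥ (x - x 0 • Pi.single 0 1) = 1 - x 0 ^ 2 := by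
    simp [dotProduct_sub, sub_dotProduct, hxx]
    ring
  set y : Fin n → ℝ := x - x 0 • Pi.single 0 1
  have hcs : (Ωd 0 ⬝ᵥ y) ^ 2 ≤ (Ωd 0 ⬝ᵥ Ωd 0) * (y ⬝ᵥ y) := by
    simpa only [dotProduct, sq] using Finset.sum_mul_sq_le_sq_mul_sq Finset.univ (Ωd 0) y
  rwa [hunit, hnorm, one_mul, ← hproj] at hcs

theorem cos_le_of_mem_closure_reachableWithin (hd : Ωd ∈ mPart n) (hΩ : ∀ k, Ω k ∈ kPart n)
    (hunit : Ωd 0 ⬝ᵥ Ωd 0 = 1) {g : SO n} {T : ℝ} (hT : T < Real.pi)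
    (hg : g ∈ closure (reachableWithin Ωd Ω T)) : Real.cos T ≤ g.1 0 0 := by
  have hclosed : IsClosed {g : SO n | Real.cos T ≤ g.1 0 0} :=
    isClosed_le continuous_const (continuous_subtype_val.matrix_elem 0 0)
  refine closure_minimal (fun h hh => ?_) hclosed hg
  simp only [reachableWithin, Set.mem_iUnion] at hh
  obtain ⟨t, ht, v, U, -, hU, rfl⟩ := hh
  exact (Real.cos_le_cos_of_nonneg_of_le_pi ht.1 hT.le ht.2).trans
    (cos_le_apply_zero_zero hd hΩ hunit hU ht.1 (ht.2.trans_lt hT))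

end Trajectories

end SOControl

/-! ### The infimizing time. -/

theorem corollary4 (n : ℕ) [NeZero n] (hn : 3 ≤ n) (m : ℕ)
    (Ωd : Matrix (Fin n) (Fin n) ℝ) (Ω : Fin m → Matrix (Fin n) (Fin n) ℝ)
    (hd : Ωd ∈ SOControl.mPart n) (hΩ : ∀ k, Ω k ∈ SOControl.kPart n)
    (hper : SOControl.ExpHasPeriod Ωd (2 * Real.pi))
    (hK : SOControl.controlGroup Ω = SOControl.subSO n)
    (ΘF : SOControl.SO n) :
    (∃! β : ℝ, β ∈ Set.Icc 0 Real.pi ∧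
      SOControl.HasDecomposition (SOControl.subSO n) Ωd ΘF β) ∧
    ∀ β ∈ Set.Icc (0 : ℝ) Real.pi,
      SOControl.HasDecomposition (SOControl.subSO n) Ωd ΘF β →
        (SOControl.steeringTimes Ωd Ω ΘF).Nonempty ∧
          SOControl.infimizingTime Ωd Ω ΘF = β := by
  have hunit := SOControl.dotProduct_self_of_period hd hper
  refine ⟨SOControl.existsUnique_hasDecomposition hn hd hunit ΘF, fun β hβ hdec => ?_⟩
  have h00 := hdec.apply_zero_zero hd hunit
  have hmem : ∀ ε > 0, β + ε ∈ SOControl.steeringTimes Ωd Ω ΘF := fun ε hε =>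
    ⟨add_nonneg hβ.1 hε.le, SOControl.mem_closure_reachableWithin_of_hasDecomposition hd.1
      (fun k => (hΩ k).1) hβ.1 (hK ▸ hdec) hε⟩
  -- Not a formality: the real `sInf` of the empty set is `0`.
  have hne : (SOControl.steeringTimes Ωd Ω ΘF).Nonempty := ⟨_, hmem 1 one_pos⟩
  refine ⟨hne, le_antisymm ?_ (le_csInf hne fun T hT => ?_)⟩
  · exact le_of_forall_pos_le_add fun ε hε => csInf_le ⟨0, fun T hT => hT.1⟩ (hmem ε hε)
  -- A time `T < β ≤ π` would give `cos T ≤ cos β`, against strict monotonicity.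
  · by_contra! hlt
    have h := SOControl.cos_le_of_mem_closure_reachableWithin hd hΩ hunit
      (hlt.trans_le hβ.2) hT.2
    rw [h00] at h
    exact absurd h (Real.cos_lt_cos_of_nonneg_of_le_pi hT.1 hβ.2 hlt).not_ge
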